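/- Let $\Gamma$ be a finitely generated group of subexponential growth, i.e. for some (equivalently, every) finite generating set, the cardinalities $\# B(n)$ of the balls of radius $n$ in the word metric satisfy $\lim_{n\to\infty} (\# B(n))^{1/n}=1$. Let $\ell^1\Gamma$ be the Banach algebra of absolutely summable functions $\Gamma\to\mathbb{C}$ under convolution, and let $\mathrm{C}^*_r\Gamma$ be the reduced $\mathrm{C}^*$-algebra of $\Gamma$, i.e. the completion of the group algebra $\mathbb{C}\Gamma$ in the operator norm coming from the left regular representation $\lambda$ on $\ell^2\Gamma$. Then the continuous unital morphism $\phi:\ell^1\Gamma\to\mathrm{C}^*_r\Gamma$, $f\mapsto\sum_{g} f(g)\lambda(g)$, is injective, has dense image, and is completely relatively spectral: for each $n$ there is a dense subalgebra $X$ of $\mathrm{M}_n(\ell^1\Gamma)$ such that the entrywise amplification $\phi_n:\mathrm{M}_n(\ell^1\Gamma)\to\mathrm{M}_n(\mathrm{C}^*_r\Gamma)$ satisfies $\mathrm{sp}(\phi_n(x))=\mathrm{sp}(x)$ for all $x\in X$. More precisely, for each $n$ the subalgebra $\mathrm{M}_n(\mathbb{C}\Gamma)$ is dense in $\mathrm{M}_n(\ell^1\Gamma)$,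 and one may take $X=\mathrm{M}_n(\mathbb{C}\Gamma)$. -/

import Mathlib

open Filter Topology
open scoped Pointwise ENNReal

noncomputable section

namespace SpectralMorphism

/-! ### Spectral properties of morphisms -/

section Morphisms

variable {A B : Type*} [Ring A] [Algebra ℂ A] [TopologicalSpace A]
  [Ring B] [Algebra ℂ B] [TopologicalSpace B]

/-- The morphism `φ : A → B` is spectrum-preserving over the subalgebra `X` of `A`. -/
def IsSpectralOver (φ : A →A[ℂ] B) (X : Subalgebra ℂ A) : Prop :=
  ∀ x ∈ X, spectrum ℂ (φ x) = spectrum ℂ x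

/-- A morphism is relatively spectral if it is spectrum-preserving over some dense subalgebra. -/
def IsRelativelySpectral (φ : A →A[ℂ] B) : Prop :=
  ∃ X : Subalgebra ℂ A, Dense (X : Set A) ∧ IsSpectralOver φ X

/-- The amplified morphism `M_n(A) → M_n(B)`, acting entrywise. The matrix algebras carry the
topology of entrywise convergence, which is the one given by any of the usual norms. -/
def amplification (n : ℕ) (φ : A →A[ℂ] B) :
    Matrix (Fin n) (Fin n) A →A[ℂ] Matrix (Fin n) (Fin n) B where
  toAlgHom := (φ : A →ₐ[ℂ] B).mapMatrix
  cont := continuous_id.matrix_map φ.cont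

/-- All amplifications `M_n(A) → M_n(B)` are relatively spectral (for `n = 0` both algebras are
zero and the condition is void). -/
def IsCompletelyRelativelySpectral (φ : A →A[ℂ] B) : Prop :=
  ∀ n : ℕ, IsRelativelySpectral (amplification n φ)

end Morphisms

/-! ### Growth of groups -/

section Growth

variable (Γ : Type*) [Group Γ]

open Classical in
/-- The ball of radius `n` in the word metric given by `S`: all products of at most `n` elements
of `S` and inverses of elements of `S`. -/
def wordBall {Γ : Type*} [Group Γ] (S : Finset Γ) (n : ℕ) : Finset Γ :=
  (insert 1 (S ∪ S⁻¹)) ^ n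

/-- A group has subexponential growth if the exponential growth rate `lim #B(n)^(1/n)` is `1` with
respect to some finite generating set (equivalently, with respect to each of them). -/
def HasSubexponentialGrowth : Prop :=
  ∃ S : Finset Γ, Subgroup.closure (S : Set Γ) = ⊤ ∧
    Tendsto (fun n : ℕ => ((wordBall S n).card : ℝ) ^ (1 / (n : ℝ))) atTop (𝓝 1)

end Growth

/-! ### The Banach algebra `ℓ¹Γ` -/

/-- The Banach space `ℓ¹Γ`, which is made into a Banach algebra with the convolution product. -/
def EllOne (Γ : Type*) : Type _ := lp (fun _ : Γ => ℂ) 1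

namespace EllOne

section Space

variable {Γ : Type*}

instance : NormedAddCommGroup (EllOne Γ) :=
  inferInstanceAs (NormedAddCommGroup (lp (fun _ : Γ => ℂ) 1))

instance : NormedSpace ℂ (EllOne Γ) :=
  inferInstanceAs (NormedSpace ℂ (lp (fun _ : Γ => ℂ) 1))

instance : CompleteSpace (EllOne Γ) :=
  inferInstanceAs (CompleteSpace (lp (fun _ : Γ => ℂ) 1))

instance : FunLike (EllOne Γ) Γ ℂ where
  coe f := fun x => f.1 x
  coe_injective _ _ h := lp.ext h

theorem ext {f g : EllOne Γ} (h : ∀ x, f x = g x) : f = g :=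
  DFunLike.ext _ _ h

theorem add_apply (f g : EllOne Γ) (x : Γ) : (f + g) x = f x + g x := rfl

theorem smul_apply (c : ℂ) (f : EllOne Γ) (x : Γ) : (c • f) x = c * f x := rfl

theorem zero_apply (x : Γ) : (0 : EllOne Γ) x = 0 := rfl

theorem hasSum_norm (f : EllOne Γ) : HasSum (fun x => ‖f x‖) ‖f‖ := by
  have h := lp.hasSum_norm (E := fun _ : Γ => ℂ) (p := 1) (by simp) f
  simp only [ENNReal.toReal_one, Real.rpow_one] at h
  exact h

theorem summable_norm (f : EllOne Γ) : Summable fun x => ‖f x‖ := (hasSum_norm f).summable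

theorem norm_apply_le (f : EllOne Γ) (x : Γ) : ‖f x‖ ≤ ‖f‖ :=
  le_hasSum f.hasSum_norm x fun _ _ => norm_nonneg _

/-- An absolutely summable function as an element of `ℓ¹Γ`. -/
def mk (f : Γ → ℂ) (hf : Summable fun x => ‖f x‖) : EllOne Γ :=
  ⟨f, memℓp_gen (by simpa using hf)⟩

theorem mk_apply (f : Γ → ℂ) (hf : Summable fun x => ‖f x‖) (x : Γ) : mk f hf x = f x := rfl

open Classical in
/-- The point mass at `g`. -/
def delta (g : Γ) : EllOne Γ := lp.single 1 g (1 : ℂ)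

open Classical in
theorem delta_apply (g x : Γ) : delta g x = if x = g then 1 else 0 := by
  split_ifs with h
  · subst h
    exact lp.single_apply_self (E := fun _ : Γ => ℂ) 1 x 1
  · exact lp.single_apply_ne (E := fun _ : Γ => ℂ) 1 g 1 h

theorem norm_delta (g : Γ) : ‖delta g‖ = 1 := by
  classical
  exact (lp.norm_single (E := fun _ : Γ => ℂ) (p := 1) (by simp) g (1 : ℂ)).trans norm_one

theorem tsum_delta {E : Type*} [NormedAddCommGroup E] [NormedSpace ℂ E] (g : Γ) (v : Γ → E) :
    ∑' x, delta g x • v x = v g := by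
  classical
  rw [tsum_eq_single g]
  · simp [delta_apply]
  · intro x hx
    simp [delta_apply, hx]

theorem summable_smul {E : Type*} [NormedAddCommGroup E] [NormedSpace ℂ E] [CompleteSpace E]
    (f : EllOne Γ) {v : Γ → E} {C : ℝ} (hv : ∀ x, ‖v x‖ ≤ C) : Summable fun x => f x • v x := by
  refine Summable.of_norm_bounded (f.summable_norm.mul_right C) fun x => ?_
  rw [norm_smul]
  gcongr
  exact hv x

end Space

section Algebra

variable {Γ : Type*} [Group Γ]

theorem summable_conv_prod (f g : EllOne Γ) :
    Summable fun p : Γ × Γ => ‖f p.1 * g (p.1⁻¹ * p.2)‖ := by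
  let e : Γ × Γ ≃ Γ × Γ :=
    { toFun := fun p => (p.1, p.1⁻¹ * p.2)
      invFun := fun p => (p.1, p.1 * p.2)
      left_inv := fun p => by simp
      right_inv := fun p => by simp }
  have h := Summable.mul_norm f.summable_norm g.summable_norm
  exact (e.summable_iff (f := fun p : Γ × Γ => ‖f p.1 * g p.2‖)).2 h

theorem summable_conv (f g : EllOne Γ) :
    Summable fun x => ‖∑' h, f h * g (h⁻¹ * x)‖ := by
  have h1 := (summable_conv_prod f g).prod_symm
  have h2 := h1.prod
  refine Summable.of_nonneg_of_le (fun _ => norm_nonneg _) (fun x => ?_) h2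
  exact norm_tsum_le_tsum_norm (h1.prod_factor x)

/-- The convolution product `(f * g)(x) = ∑ h, f(h) g(h⁻¹x)`. -/
instance : Mul (EllOne Γ) := ⟨fun f g => mk (fun x => ∑' h, f h * g (h⁻¹ * x)) (summable_conv f g)⟩

instance : One (EllOne Γ) := ⟨delta 1⟩

theorem mul_apply (f g : EllOne Γ) (x : Γ) : (f * g) x = ∑' h, f h * g (h⁻¹ * x) := rfl

theorem one_def : (1 : EllOne Γ) = delta 1 := rfl

/-- Integration of a bounded function against a convolution. -/
theorem tsum_mul_smul {E : Type*} [NormedAddCommGroup E] [NormedSpace ℂ E] [CompleteSpace E]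
    (f g : EllOne Γ) {v : Γ → E} {C : ℝ} (hv : ∀ x, ‖v x‖ ≤ C) :
    ∑' x, (f * g) x • v x = ∑' h, f h • ∑' k, g k • v (h * k) := by
  have hs : Summable fun p : Γ × Γ => (f p.1 * g (p.1⁻¹ * p.2)) • v p.2 := by
    refine Summable.of_norm_bounded ((summable_conv_prod f g).mul_right C) fun p => ?_
    rw [norm_smul]
    gcongr
    exact hv _
  have hc : ∀ x, Summable fun h => f h * g (h⁻¹ * x) := fun x =>
    Summable.of_norm ((summable_conv_prod f g).prod_symm.prod_factor x)
  calc ∑' x, (f * g) x • v x = ∑' x, ∑' h, (f h * g (h⁻¹ * x)) • v x := by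
        refine tsum_congr fun x => ?_
        rw [mul_apply, (hc x).tsum_smul_const]
    _ = ∑' h, ∑' x, (f h * g (h⁻¹ * x)) • v x :=
        Summable.tsum_comm (f := fun h x => (f h * g (h⁻¹ * x)) • v x) hs
    _ = ∑' h, f h • ∑' k, g k • v (h * k) := by
        refine tsum_congr fun h => ?_
        have hg : Summable fun k => g k • v (h * k) := summable_smul g fun k => hv _
        rw [← hg.tsum_const_smul,
          ← (Equiv.mulLeft h).tsum_eq fun x => (f h * g (h⁻¹ * x)) • v x]
        refine tsum_congr fun k => ?_
        rw [Equiv.coe_mulLeft, inv_mul_cancel_left, mul_smul]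

theorem norm_mul_le' (f g : EllOne Γ) : ‖f * g‖ ≤ ‖f‖ * ‖g‖ := by
  have h1 := (summable_conv_prod f g).prod_symm
  rw [← (hasSum_norm (f * g)).tsum_eq]
  calc ∑' x, ‖(f * g) x‖ ≤ ∑' x, ∑' h, ‖f h * g (h⁻¹ * x)‖ :=
        Summable.tsum_le_tsum (fun x => norm_tsum_le_tsum_norm (h1.prod_factor x))
          (summable_norm _) h1.prod
    _ = ∑' h, ∑' x, ‖f h * g (h⁻¹ * x)‖ := Summable.tsum_comm (summable_conv_prod f g)
    _ = ∑' h, ‖f h‖ * ‖g‖ := by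
        refine tsum_congr fun h => ?_
        rw [← (hasSum_norm g).tsum_eq, ← tsum_mul_left,
          ← (Equiv.mulLeft h).tsum_eq fun x => ‖f h * g (h⁻¹ * x)‖]
        simp
    _ = ‖f‖ * ‖g‖ := by rw [tsum_mul_right, (hasSum_norm f).tsum_eq]

theorem summable_conv_apply (f g : EllOne Γ) (x : Γ) : Summable fun h => f h * g (h⁻¹ * x) :=
  Summable.of_norm ((summable_conv_prod f g).prod_symm.prod_factor x)

instance : NormedRing (EllOne Γ) :=
  { (inferInstance : NormedAddCommGroup (EllOne Γ)) with
    mul := (· * ·)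
    one := 1
    left_distrib := fun f g k => ext fun x => by
      simp only [mul_apply, add_apply, mul_add]
      exact (summable_conv_apply f g x).tsum_add (summable_conv_apply f k x)
    right_distrib := fun f g k => ext fun x => by
      simp only [mul_apply, add_apply, add_mul]
      exact (summable_conv_apply f k x).tsum_add (summable_conv_apply g k x)
    zero_mul := fun f => ext fun x => by simp [mul_apply, zero_apply]
    mul_zero := fun f => ext fun x => by simp [mul_apply, zero_apply]
    mul_assoc := fun f g k => ext fun x => by
      have h := tsum_mul_smul f g (v := fun y => k (y⁻¹ * x)) (fun y => norm_apply_le k _)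
      simp only [smul_eq_mul, mul_inv_rev] at h
      rw [mul_apply, mul_apply, h]
      simp only [mul_apply, mul_assoc]
    one_mul := fun f => ext fun x => by
      have h := tsum_delta 1 (fun h => f (h⁻¹ * x))
      simp only [smul_eq_mul, inv_one, one_mul] at h
      rw [mul_apply, one_def, h]
    mul_one := fun f => ext fun x => by
      classical
      rw [mul_apply, tsum_eq_single x]
      · simp [one_def, delta_apply]
      · intro y hy
        have : y⁻¹ * x ≠ 1 := fun h => hy (inv_mul_eq_one.1 h)
        simp [one_def, delta_apply, this]
    norm_mul_le := norm_mul_le'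
    dist_eq := fun f g => dist_eq_norm_neg_add f g }

instance : NormedAlgebra ℂ (EllOne Γ) :=
  { Algebra.ofModule (R := ℂ) (A := EllOne Γ)
      (fun c f g => ext fun x => by
        simp only [mul_apply, smul_apply, mul_assoc, tsum_mul_left])
      (fun c f g => ext fun x => by
        simp only [mul_apply, smul_apply, mul_left_comm _ c, tsum_mul_left]) with
    norm_smul_le := norm_smul_le }

theorem delta_mul (g h : Γ) : (delta (g * h) : EllOne Γ) = delta g * delta h := by
  classical
  refine ext fun x => ?_
  have := tsum_delta g (fun y => delta h (y⁻¹ * x))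
  simp only [smul_eq_mul] at this
  rw [mul_apply, this]
  simp only [delta_apply, inv_mul_eq_iff_eq_mul]

variable (Γ) in
/-- The group algebra `ℂΓ` inside `ℓ¹Γ`, with `g` mapped to the point mass at `g`. -/
def ofGroupAlgebra : MonoidAlgebra ℂ Γ →ₐ[ℂ] EllOne Γ :=
  MonoidAlgebra.lift ℂ (EllOne Γ) Γ
    { toFun := delta
      map_one' := rfl
      map_mul' := delta_mul }

/-- A homomorphism from `Γ` to the contractions of a Banach algebra extends to `ℓ¹Γ` by
`f ↦ ∑ g, f(g) u(g)`. -/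
def extend {A : Type*} [NormedRing A] [NormedAlgebra ℂ A] [CompleteSpace A] (u : Γ →* A)
    (hu : ∀ g, ‖u g‖ ≤ 1) : EllOne Γ →A[ℂ] A where
  toFun f := ∑' g, f g • u g
  map_one' := by rw [one_def, tsum_delta, map_one]
  map_mul' f g := by
    rw [tsum_mul_smul f g hu, ← (summable_smul f hu).tsum_mul_right]
    refine tsum_congr fun h => ?_
    rw [smul_mul_assoc, ← (summable_smul g hu).tsum_mul_left]
    simp only [map_mul, mul_smul_comm]
  map_zero' := by simp [zero_apply]
  map_add' f g := by
    rw [← (summable_smul f hu).tsum_add (summable_smul g hu)]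
    simp only [add_apply, add_smul]
  commutes' c := by
    rw [Algebra.algebraMap_eq_smul_one, Algebra.algebraMap_eq_smul_one]
    simp only [smul_apply, mul_smul]
    rw [(summable_smul (1 : EllOne Γ) hu).tsum_const_smul, one_def, tsum_delta, map_one]
  cont := by
    let L : EllOne Γ →ₗ[ℂ] A :=
      { toFun := fun f => ∑' g, f g • u g
        map_add' := fun f g => by
          rw [← (summable_smul f hu).tsum_add (summable_smul g hu)]
          simp only [add_apply, add_smul]
        map_smul' := fun c f => by
          simp only [smul_apply, mul_smul]
          exact (summable_smul f hu).tsum_const_smul c }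
    refine AddMonoidHomClass.continuous_of_bound L 1 fun f => ?_
    rw [one_mul]
    refine tsum_of_norm_bounded (hasSum_norm f) fun g => ?_
    rw [norm_smul]
    exact mul_le_of_le_one_right (norm_nonneg _) (hu g)

end Algebra

end EllOne

/-! ### The reduced C*-algebra -/

section Reduced

variable (Γ : Type*) [Group Γ]

/-- The Hilbert space `ℓ²Γ`. -/
abbrev EllTwo (Γ : Type*) : Type _ := lp (fun _ : Γ => ℂ) 2

variable {Γ} in
theorem memℓp_translate (g : Γ) (ξ : EllTwo Γ) :
    Memℓp (fun x => ξ (g⁻¹ * x)) 2 := by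
  have h := (lp.memℓp ξ).summable (by simp)
  exact memℓp_gen ((Equiv.mulLeft g⁻¹).summable_iff.2 h)

variable {Γ} in
/-- Left translation by `g` on `ℓ²Γ`, as a linear isometry. -/
def translate (g : Γ) : EllTwo Γ →ₗᵢ[ℂ] EllTwo Γ where
  toFun ξ := ⟨fun x => ξ (g⁻¹ * x), memℓp_translate g ξ⟩
  map_add' _ _ := rfl
  map_smul' _ _ := rfl
  norm_map' ξ := by
    change ‖(⟨fun x => ξ (g⁻¹ * x), memℓp_translate g ξ⟩ : EllTwo Γ)‖ = ‖ξ‖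
    rw [lp.norm_eq_tsum_rpow (by simp), lp.norm_eq_tsum_rpow (by simp)]
    congr 1
    exact (Equiv.mulLeft g⁻¹).tsum_eq (fun x => ‖ξ x‖ ^ (2 : ℝ≥0∞).toReal)

/-- The left regular representation `(λ(g)ξ)(x) = ξ(g⁻¹x)` of `Γ` on `ℓ²Γ`. -/
def leftRegular : Γ →* (EllTwo Γ →L[ℂ] EllTwo Γ) where
  toFun g := (translate g).toContinuousLinearMap
  map_one' := by
    ext ξ x
    change ξ (1⁻¹ * x) = ξ x
    simp
  map_mul' g h := by
    ext ξ x
    change ξ ((g * h)⁻¹ * x) = ξ (h⁻¹ * (g⁻¹ * x))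
    simp [mul_assoc]

variable {Γ} in
theorem leftRegular_apply (g : Γ) (ξ : EllTwo Γ) (x : Γ) : leftRegular Γ g ξ x = ξ (g⁻¹ * x) := rfl

variable {Γ} in
theorem norm_leftRegular_le (g : Γ) : ‖leftRegular Γ g‖ ≤ 1 :=
  (translate g).norm_toContinuousLinearMap_le

variable {Γ} in
theorem star_leftRegular (g : Γ) : star (leftRegular Γ g) = leftRegular Γ g⁻¹ := by
  rw [ContinuousLinearMap.star_eq_adjoint]
  symm
  rw [ContinuousLinearMap.eq_adjoint_iff]
  intro ξ η
  rw [lp.inner_eq_tsum, lp.inner_eq_tsum, ← (Equiv.mulLeft g⁻¹).tsum_eq]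
  simp [leftRegular_apply]

/-- The linear extension of the left regular representation to the group algebra `ℂΓ`. -/
def groupAlgebraRep : MonoidAlgebra ℂ Γ →ₐ[ℂ] (EllTwo Γ →L[ℂ] EllTwo Γ) :=
  MonoidAlgebra.lift ℂ (EllTwo Γ →L[ℂ] EllTwo Γ) Γ (leftRegular Γ)

variable {Γ} in
theorem groupAlgebraRep_single (g : Γ) (c : ℂ) :
    groupAlgebraRep Γ (MonoidAlgebra.single g c) = c • leftRegular Γ g := by
  simp [groupAlgebraRep, MonoidAlgebra.lift_single]

/-- The image of the group algebra `ℂΓ` in the bounded operators on `ℓ²Γ`. -/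
def groupAlgebraOperators : StarSubalgebra ℂ (EllTwo Γ →L[ℂ] EllTwo Γ) :=
  { (groupAlgebraRep Γ).range with
    star_mem' := by
      rintro _ ⟨a, rfl⟩
      change star (groupAlgebraRep Γ a) ∈ (groupAlgebraRep Γ).range
      induction a using MonoidAlgebra.induction_linear with
      | zero => simp
      | add a b ha hb =>
        rw [map_add, star_add]
        exact add_mem ha hb
      | single g c =>
        refine ⟨MonoidAlgebra.single g⁻¹ (star c), ?_⟩
        change groupAlgebraRep Γ _ = _
        rw [groupAlgebraRep_single, groupAlgebraRep_single, star_smul, star_leftRegular] }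

/-- The reduced C*-algebra of `Γ`: the completion of `ℂΓ` in the operator norm coming from the
regular representation on `ℓ²Γ`, that is, the norm closure of `ℂΓ` in the bounded operators. -/
def reducedCStarAlgebra : StarSubalgebra ℂ (EllTwo Γ →L[ℂ] EllTwo Γ) :=
  (groupAlgebraOperators Γ).topologicalClosure

instance : CompleteSpace (reducedCStarAlgebra Γ) :=
  inferInstanceAs (CompleteSpace (groupAlgebraOperators Γ).topologicalClosure)

theorem leftRegular_mem (g : Γ) : leftRegular Γ g ∈ reducedCStarAlgebra Γ := by
  refine (groupAlgebraOperators Γ).le_topologicalClosure ?_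
  exact ⟨MonoidAlgebra.single g 1, by
    change groupAlgebraRep Γ _ = _
    rw [groupAlgebraRep_single, one_smul]⟩

/-- The left regular representation with values in the reduced C*-algebra. -/
def leftRegularReduced : Γ →* reducedCStarAlgebra Γ where
  toFun g := ⟨leftRegular Γ g, leftRegular_mem Γ g⟩
  map_one' := Subtype.ext (map_one _)
  map_mul' g h := Subtype.ext (map_mul _ g h)

/-- The inclusion `ℓ¹Γ → C*_r Γ`, `f ↦ ∑ g, f(g) λ(g)`. -/
def ellOneInclusion : EllOne Γ →A[ℂ] reducedCStarAlgebra Γ :=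
  EllOne.extend (leftRegularReduced Γ) norm_leftRegular_le

/-- The subalgebra `M_n(ℂΓ)` of `M_n(ℓ¹Γ)`. -/
def matrixGroupAlgebra (n : ℕ) : Subalgebra ℂ (Matrix (Fin n) (Fin n) (EllOne Γ)) :=
  ((EllOne.ofGroupAlgebra Γ).mapMatrix (m := Fin n)).range

end Reduced

end SpectralMorphism

end

/-! Subexponential growth makes the `ℓ¹` norm of high powers almost as small as the operator norm.
Let `z` be a matrix over `ℂΓ` with entries supported in the ball `B(R)` and with images in `C*_r Γ`
of norm at most `ε`, where `nε < 1`. The entries of `z ^ k` live on `B(kR)`, and each coefficient is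
at most the operator norm of the image, hence at most `‖1‖ (nε)^k`. So their `ℓ¹` norms are at most
`#B(kR) ‖1‖ (nε)^k`, which is summable by the root test, and `1 - z` is inverted by its geometric
series (`summable_matrix_pow`).

Thus `1 - z` is invertible as soon as the image of `z` is near `0`. Since `M_n(ℂΓ)` has dense image,
approximating inverses from it upgrades this to equality of spectra
(`IsSpectralOver.of_isUnit_one_sub`). The coefficient bound also gives injectivity. -/

namespace SpectralMorphism

/-! ### Spectral invariance from invertibility near the identity -/

section Morphisms

variable {A B : Type*} [Ring A] [Algebra ℂ A] [TopologicalSpace A]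
  [Ring B] [Algebra ℂ B] [TopologicalSpace B]

/-- A morphism mapping `X` densely is spectrum-preserving over `X` as soon as elements of `1 - X`
whose image is close to `1` are invertible. -/
theorem IsSpectralOver.of_isUnit_one_sub [IsTopologicalRing B] {φ : A →A[ℂ] B}
    {X : Subalgebra ℂ A} (hX : Dense (φ '' (X : Set A))) {U : Set B} (hU : U ∈ 𝓝 0)
    (h : ∀ z ∈ X, φ z ∈ U → IsUnit (1 - z)) : IsSpectralOver φ X := by
  -- Approximate the inverse of `φ x` by some `φ y` with `y ∈ X`, so closely that `1 - x * y` and `1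
  -- - y * x` both map into `U`.
  have key : ∀ x ∈ X, IsUnit (φ x) → IsUnit x := by
    intro x hx hu
    obtain ⟨u, hu⟩ := hu
    have h1 : Tendsto (fun y : B => 1 - φ x * y) (𝓝 ↑u⁻¹) (𝓝 0) := by
      have : Continuous fun y : B => 1 - φ x * y := by fun_prop
      simpa [← hu] using this.tendsto (↑u⁻¹ : B)
    have h2 : Tendsto (fun y : B => 1 - y * φ x) (𝓝 ↑u⁻¹) (𝓝 0) := by
      have : Continuous fun y : B => 1 - y * φ x := by fun_prop
      simpa [← hu] using this.tendsto (↑u⁻¹ : B)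
    obtain ⟨_, ⟨hy1, hy2⟩, y, hy, rfl⟩ :=
      mem_closure_iff_nhds.1 (hX ↑u⁻¹) _ (inter_mem (h1 hU) (h2 hU))
    have e1 : IsUnit (x * y) := by
      simpa using h (1 - x * y) (sub_mem (one_mem X) (mul_mem hx hy)) (by simpa using hy1)
    have e2 : IsUnit (y * x) := by
      simpa using h (1 - y * x) (sub_mem (one_mem X) (mul_mem hy hx)) (by simpa using hy2)
    -- `A` need not be commutative: `x * y` yields a right inverse of `x`, `y * x` a left inverse,
    -- and the two agree.
    obtain ⟨c, hc⟩ := e1.exists_right_inv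
    obtain ⟨d, hd⟩ := e2.exists_left_inv
    rw [mul_assoc] at hc
    rw [← mul_assoc] at hd
    exact isUnit_iff_exists.2 ⟨y * c, hc, by rwa [← left_inv_eq_right_inv hd hc]⟩
  intro x hx
  ext r
  rw [spectrum.mem_iff, spectrum.mem_iff, not_iff_not]
  have e : algebraMap ℂ B r - φ x = φ (algebraMap ℂ A r - x) := by
    rw [map_sub, AlgHomClass.commutes φ r]
  rw [e]
  exact ⟨key _ (sub_mem (X.algebraMap_mem r) hx), fun hu => hu.map φ⟩

end Morphisms

/-! ### Entrywise bounds for matrix powers -/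

section Matrix

/-- Each further factor sums `n` products, costing `n * ε`. The constant `‖1‖` comes from `k = 0`,
as `B` is not assumed to have a unit of norm one. -/
theorem norm_matrix_pow_apply_le {B : Type*} [NormedRing B] {n : ℕ}
    {w : Matrix (Fin n) (Fin n) B} {ε : ℝ} (hw : ∀ i j, ‖w i j‖ ≤ ε) (k : ℕ) (i j : Fin n) :
    ‖(w ^ k) i j‖ ≤ ‖(1 : B)‖ * (n * ε) ^ k := by
  induction k generalizing i j with
  | zero =>
    rw [pow_zero, pow_zero, mul_one, Matrix.one_apply]
    split_ifs
    · exact le_rfl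
    · simp
  | succ k ih =>
    rw [pow_succ, Matrix.mul_apply]
    calc ‖∑ l, (w ^ k) i l * w l j‖ ≤ ∑ _l : Fin n, ‖(1 : B)‖ * (n * ε) ^ k * ε := by
          refine norm_sum_le_of_le _ fun l _ => (norm_mul_le _ _).trans ?_
          exact mul_le_mul (ih i l) (hw l j) (norm_nonneg _) ((norm_nonneg _).trans (ih i l))
      _ = ‖(1 : B)‖ * (n * ε) ^ (k + 1) := by
          rw [Finset.sum_const, Finset.card_univ, Fintype.card_fin, nsmul_eq_mul]
          ring

end Matrix

/-! ### Word balls and the root test -/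

section Growth

variable {Γ : Type*} [Group Γ]

theorem one_mem_wordBall (S : Finset Γ) (n : ℕ) : 1 ∈ wordBall S n := by
  classical
  exact Finset.one_mem_pow (Finset.mem_insert_self _ _)

theorem wordBall_mono (S : Finset Γ) : Monotone (wordBall S) := fun _ _ h => by
  classical
  exact Finset.pow_subset_pow_right (Finset.mem_insert_self _ _) h

theorem mul_mem_wordBall {S : Finset Γ} {m n : ℕ} {x y : Γ} (hx : x ∈ wordBall S m)
    (hy : y ∈ wordBall S n) : x * y ∈ wordBall S (m + n) := by
  classical
  rw [wordBall, pow_add]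
  exact Finset.mul_mem_mul hx hy

theorem exists_mem_wordBall {S : Finset Γ} (hS : Subgroup.closure (S : Set Γ) = ⊤) (x : Γ) :
    ∃ n, x ∈ wordBall S n := by
  classical
  have hx : x ∈ Subgroup.closure (S : Set Γ) := hS ▸ Subgroup.mem_top x
  induction hx using Subgroup.closure_induction'' with
  | mem x hx => exact ⟨1, by simp [wordBall, Finset.mem_coe.1 hx]⟩
  | inv_mem x hx => exact ⟨1, by simp [wordBall, Finset.mem_coe.1 hx]⟩
  | one => exact ⟨0, one_mem_wordBall S 0⟩
  | mul x y _ _ hx hy =>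
    obtain ⟨m, hm⟩ := hx
    obtain ⟨n, hn⟩ := hy
    exact ⟨m + n, mul_mem_wordBall hm hn⟩

theorem exists_subset_wordBall {S : Finset Γ} (hS : Subgroup.closure (S : Set Γ) = ⊤)
    (F : Finset Γ) : ∃ n, F ⊆ wordBall S n := by
  choose r hr using exists_mem_wordBall hS
  exact ⟨F.sup r, fun x hx => wordBall_mono S (Finset.le_sup hx) (hr x)⟩

/-- Root test: the `k`-th root of the term is `(#B(kR)^(1/(kR)))^R * ρ`, which tends to `ρ < 1`, so
the terms are eventually below `σ ^ k` for any `σ` between `ρ` and `1`. -/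
theorem summable_card_wordBall_mul_pow {S : Finset Γ}
    (hS : Tendsto (fun n : ℕ => ((wordBall S n).card : ℝ) ^ (1 / (n : ℝ))) atTop (𝓝 1))
    {R : ℕ} (hR : 0 < R) {ρ : ℝ} (hρ : 0 ≤ ρ) (hρ1 : ρ < 1) :
    Summable fun k : ℕ => ((wordBall S (k * R)).card : ℝ) * ρ ^ k := by
  have h1 : Tendsto (fun n : ℕ => (((wordBall S n).card : ℝ) ^ (1 / (n : ℝ))) ^ R * ρ)
      atTop (𝓝 ρ) := by
    simpa using (hS.pow R).mul_const ρ
  obtain ⟨σ, hρσ, hσ1⟩ := exists_between hρ1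
  have h2 := (tendsto_id.atTop_mul_const' hR).eventually (h1.eventually (gt_mem_nhds hρσ))
  refine Summable.of_norm_bounded_eventually_nat
    (summable_geometric_of_lt_one (hρ.trans hρσ.le) hσ1) ?_
  filter_upwards [h2, eventually_gt_atTop 0] with k hk hk0
  rw [Real.norm_of_nonneg (by positivity)]
  have hkR : ((k * R : ℕ) : ℝ) ≠ 0 := by positivity
  have e : ((wordBall S (k * R)).card : ℝ) * ρ ^ k
      = ((((wordBall S (k * R)).card : ℝ) ^ (1 / ((k * R : ℕ) : ℝ))) ^ R * ρ) ^ k := by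
    rw [mul_pow, ← pow_mul, mul_comm R k, ← Real.rpow_natCast _ (k * R), ← Real.rpow_mul
      (by positivity), one_div, inv_mul_cancel₀ hkR, Real.rpow_one]
  rw [e]
  exact pow_le_pow_left₀ (by positivity) hk.le k

end Growth

/-! ### Finitely supported elements of `ℓ¹Γ` and supports of powers -/

namespace EllOne

section Space

variable {Γ : Type*}

theorem hasSum_smul_delta (f : EllOne Γ) : HasSum (fun g => f g • delta g) f := by
  classical
  have h := lp.hasSum_single (E := fun _ : Γ => ℂ) (p := 1) ENNReal.one_ne_top f
  have e : (fun g => f g • delta g) = fun g : Γ => (lp.single 1 g (f.1 g) : EllOne Γ) := by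
    funext g
    refine ext fun x => ?_
    rw [smul_apply, delta_apply]
    change _ = (lp.single (E := fun _ : Γ => ℂ) 1 g (f.1 g)) x
    rw [lp.single_apply]
    by_cases hx : x = g
    · subst hx
      simp
      rfl
    · simp [hx]
  rw [e]
  exact h

/-- Trades a sup bound for an `ℓ¹` bound at the cost of the support size, which is how ball growth
enters. -/
theorem norm_le_card_mul {f : EllOne Γ} {s : Finset Γ} (hf : ∀ x ∉ s, f x = 0) {C : ℝ}
    (hC : ∀ x, ‖f x‖ ≤ C) : ‖f‖ ≤ s.card * C := by
  rw [← (hasSum_norm f).tsum_eq, tsum_eq_sum fun x hx => by rw [hf x hx, norm_zero],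
    ← nsmul_eq_mul]
  exact Finset.sum_le_card_nsmul _ _ _ fun x _ => hC x

theorem sum_apply {ι : Type*} (s : Finset ι) (f : ι → EllOne Γ) (x : Γ) :
    (∑ i ∈ s, f i) x = ∑ i ∈ s, f i x := by
  classical
  induction s using Finset.induction_on with
  | empty => simp [zero_apply]
  | insert i s hi ih => rw [Finset.sum_insert hi, Finset.sum_insert hi, add_apply, ih]

end Space

section Algebra

variable {Γ : Type*} [Group Γ]

theorem ofGroupAlgebra_single (g : Γ) (c : ℂ) :
    ofGroupAlgebra Γ (MonoidAlgebra.single g c) = c • delta g := by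
  simp [ofGroupAlgebra, MonoidAlgebra.lift_single]

theorem denseRange_ofGroupAlgebra : DenseRange (ofGroupAlgebra Γ) := by
  intro f
  refine mem_closure_of_tendsto f.hasSum_smul_delta (Eventually.of_forall fun s => ?_)
  exact ⟨∑ g ∈ s, MonoidAlgebra.single g (f g), by simp [map_sum, ofGroupAlgebra_single]⟩

theorem exists_finset_ofGroupAlgebra (a : MonoidAlgebra ℂ Γ) :
    ∃ F : Finset Γ, ∀ x ∉ F, ofGroupAlgebra Γ a x = 0 := by
  classical
  induction a using MonoidAlgebra.induction_linear with
  | zero => exact ⟨∅, fun x _ => by rw [map_zero, zero_apply]⟩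
  | add a b ha hb =>
    obtain ⟨F, hF⟩ := ha
    obtain ⟨G, hG⟩ := hb
    refine ⟨F ∪ G, fun x hx => ?_⟩
    rw [Finset.notMem_union] at hx
    rw [map_add, add_apply, hF x hx.1, hG x hx.2, add_zero]
  | single g c =>
    refine ⟨{g}, fun x hx => ?_⟩
    rw [Finset.mem_singleton] at hx
    rw [ofGroupAlgebra_single, smul_apply, delta_apply, if_neg hx, mul_zero]

theorem mul_apply_eq_zero {S : Finset Γ} {m n : ℕ} {f g : EllOne Γ}
    (hf : ∀ x ∉ wordBall S m, f x = 0) (hg : ∀ x ∉ wordBall S n, g x = 0) :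
    ∀ x ∉ wordBall S (m + n), (f * g) x = 0 := by
  intro x hx
  rw [mul_apply]
  refine (tsum_congr fun h => ?_).trans tsum_zero
  by_cases h1 : h ∈ wordBall S m
  · by_cases h2 : h⁻¹ * x ∈ wordBall S n
    · exact absurd (by simpa using mul_mem_wordBall h1 h2) hx
    · rw [hg _ h2, mul_zero]
  · rw [hf _ h1, zero_mul]

theorem matrix_pow_apply_eq_zero {S : Finset Γ} {R n : ℕ} {z : Matrix (Fin n) (Fin n) (EllOne Γ)}
    (hz : ∀ i j, ∀ x ∉ wordBall S R, z i j x = 0) (k : ℕ) :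
    ∀ i j, ∀ x ∉ wordBall S (k * R), (z ^ k) i j x = 0 := by
  classical
  induction k with
  | zero =>
    intro i j x hx
    have hx1 : x ≠ 1 := fun h => hx (h ▸ one_mem_wordBall S _)
    rw [pow_zero, Matrix.one_apply]
    split_ifs
    · rw [one_def, delta_apply, if_neg hx1]
    · rw [zero_apply]
  | succ k ih =>
    intro i j x hx
    rw [pow_succ, Matrix.mul_apply, sum_apply]
    rw [Nat.succ_mul] at hx
    exact Finset.sum_eq_zero fun l _ => mul_apply_eq_zero (ih i l) (hz l j) x hx

end Algebra

end EllOne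

/-! ### Comparison of `ℓ¹Γ` with the reduced C*-algebra -/

section Reduced

variable {Γ : Type*} [Group Γ]

theorem coe_ellOneInclusion (f : EllOne Γ) :
    (ellOneInclusion Γ f : EllTwo Γ →L[ℂ] EllTwo Γ) = ∑' g, f g • leftRegular Γ g := by
  have h : Summable fun g => f g • leftRegularReduced Γ g :=
    EllOne.summable_smul f (C := 1) norm_leftRegular_le
  exact h.map_tsum (reducedCStarAlgebra Γ).subtype continuous_subtype_val

open Classical in
theorem ellOneInclusion_apply_single (f : EllOne Γ) (x : Γ) :
    (ellOneInclusion Γ f : EllTwo Γ →L[ℂ] EllTwo Γ) (lp.single 2 1 (1 : ℂ)) x = f x := by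
  have h : Summable fun g => f g • leftRegular Γ g :=
    EllOne.summable_smul f (C := 1) norm_leftRegular_le
  let L : (EllTwo Γ →L[ℂ] EllTwo Γ) →L[ℂ] ℂ :=
    (lp.evalCLM ℂ (fun _ : Γ => ℂ) 2 x).comp
      (ContinuousLinearMap.apply ℂ (EllTwo Γ) (lp.single 2 1 (1 : ℂ)))
  have e : L (∑' g, f g • leftRegular Γ g) = f x := by
    rw [L.map_tsum h, tsum_eq_single x]
    · change f x * leftRegular Γ x (lp.single 2 1 (1 : ℂ)) x = f x
      rw [leftRegular_apply, inv_mul_cancel, lp.single_apply_self, mul_one]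
    · intro g hg
      change f g * leftRegular Γ g (lp.single 2 1 (1 : ℂ)) x = 0
      rw [leftRegular_apply, lp.single_apply_ne _ _ _ fun h => hg (inv_mul_eq_one.1 h), mul_zero]
  rw [coe_ellOneInclusion]
  exact e

/-- The operator sends the unit vector at `1` to `f` itself, so no coefficient of `f` exceeds the
operator norm. -/
theorem norm_apply_le_norm_ellOneInclusion (f : EllOne Γ) (x : Γ) :
    ‖f x‖ ≤ ‖ellOneInclusion Γ f‖ := by
  classical
  rw [← ellOneInclusion_apply_single]
  refine (lp.norm_apply_le_norm (by simp) _ x).trans ?_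
  refine (ContinuousLinearMap.le_opNorm _ _).trans ?_
  rw [lp.norm_single (by simp), norm_one, mul_one]
  rfl

theorem injective_ellOneInclusion : Function.Injective (ellOneInclusion Γ) := by
  refine (injective_iff_map_eq_zero _).2 fun f hf => EllOne.ext fun x => ?_
  simpa [hf, EllOne.zero_apply] using norm_apply_le_norm_ellOneInclusion f x

theorem ellOneInclusion_ofGroupAlgebra (a : MonoidAlgebra ℂ Γ) :
    (ellOneInclusion Γ (EllOne.ofGroupAlgebra Γ a) : EllTwo Γ →L[ℂ] EllTwo Γ)
      = groupAlgebraRep Γ a := by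
  induction a using MonoidAlgebra.induction_linear with
  | zero => simp
  | add a b ha hb => simp [ha, hb]
  | single g c =>
    rw [EllOne.ofGroupAlgebra_single, groupAlgebraRep_single, map_smul]
    change c • (ellOneInclusion Γ (EllOne.delta g) : EllTwo Γ →L[ℂ] EllTwo Γ) = _
    rw [coe_ellOneInclusion]
    exact congrArg (c • ·) (EllOne.tsum_delta g (leftRegular Γ))

theorem denseRange_ellOneInclusion_ofGroupAlgebra :
    DenseRange fun a => ellOneInclusion Γ (EllOne.ofGroupAlgebra Γ a) := by
  refine Subtype.dense_iff.2 fun y hy => ?_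
  refine closure_mono ?_ (show y ∈ closure (groupAlgebraOperators Γ : Set _) from hy)
  rintro _ ⟨a, rfl⟩
  exact ⟨_, ⟨a, rfl⟩, ellOneInclusion_ofGroupAlgebra a⟩

theorem denseRange_ellOneInclusion : DenseRange (ellOneInclusion Γ) :=
  denseRange_ellOneInclusion_ofGroupAlgebra.mono
    (Set.range_comp_subset_range (EllOne.ofGroupAlgebra Γ) (ellOneInclusion Γ))

theorem denseRange_matrix_map {n : ℕ} {α β : Type*} [TopologicalSpace β] {f : α → β}
    (hf : DenseRange f) : DenseRange fun M : Matrix (Fin n) (Fin n) α => M.map f :=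
  DenseRange.piMap fun _ => DenseRange.piMap fun _ => hf

theorem dense_matrixGroupAlgebra (n : ℕ) :
    Dense (matrixGroupAlgebra Γ n : Set (Matrix (Fin n) (Fin n) (EllOne Γ))) :=
  denseRange_matrix_map EllOne.denseRange_ofGroupAlgebra

theorem dense_amplification_image (n : ℕ) :
    Dense (amplification n (ellOneInclusion Γ) '' (matrixGroupAlgebra Γ n : Set _)) := by
  refine (denseRange_matrix_map (n := n) denseRange_ellOneInclusion_ofGroupAlgebra).mono ?_
  rintro _ ⟨M, rfl⟩
  exact ⟨_, ⟨M, rfl⟩, rfl⟩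

theorem exists_wordBall_of_mem_matrixGroupAlgebra {S : Finset Γ}
    (hS : Subgroup.closure (S : Set Γ) = ⊤) {n : ℕ} {z : Matrix (Fin n) (Fin n) (EllOne Γ)}
    (hz : z ∈ matrixGroupAlgebra Γ n) :
    ∃ R, 0 < R ∧ ∀ i j, ∀ x ∉ wordBall S R, z i j x = 0 := by
  classical
  obtain ⟨M, rfl⟩ := hz
  choose F hF using fun i j => EllOne.exists_finset_ofGroupAlgebra (M i j)
  obtain ⟨R, hR⟩ := exists_subset_wordBall hS
    (Finset.univ.biUnion fun i => Finset.univ.biUnion fun j => F i j)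
  -- Enlarging `R` by one makes it positive, so that `k * R` tends to infinity in the root test.
  refine ⟨R + 1, R.succ_pos, fun i j x hx => hF i j x fun h => hx ?_⟩
  exact wordBall_mono S R.le_succ (hR (by simpa using ⟨i, j, h⟩))

/-- Over a group of subexponential growth, the geometric series of a matrix over `ℂΓ` converges in
`M_n(ℓ¹Γ)` as soon as its image in `M_n(C*_r Γ)` is small. -/
theorem summable_matrix_pow (hΓ : HasSubexponentialGrowth Γ) {n : ℕ}
    {z : Matrix (Fin n) (Fin n) (EllOne Γ)} (hz : z ∈ matrixGroupAlgebra Γ n) {ε : ℝ}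
    (hε : 0 ≤ ε) (hnε : n * ε < 1) (hzε : ∀ i j, ‖ellOneInclusion Γ (z i j)‖ ≤ ε) :
    Summable (z ^ ·) := by
  obtain ⟨S, hS, hgrowth⟩ := hΓ
  obtain ⟨R, hR, hzR⟩ := exists_wordBall_of_mem_matrixGroupAlgebra hS hz
  have hs := (summable_card_wordBall_mul_pow hgrowth hR (by positivity) hnε).mul_left
    ‖(1 : reducedCStarAlgebra Γ)‖
  refine Pi.summable.2 fun i => Pi.summable.2 fun j => Summable.of_norm_bounded hs fun k => ?_
  have hpow : ellOneInclusion Γ ((z ^ k) i j)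
      = ((amplification n (ellOneInclusion Γ) z) ^ k) i j := by
    rw [← map_pow]
    rfl
  have hk : ‖ellOneInclusion Γ ((z ^ k) i j)‖ ≤ ‖(1 : reducedCStarAlgebra Γ)‖ * (n * ε) ^ k := by
    rw [hpow]
    exact norm_matrix_pow_apply_le hzε k i j
  -- Support size `#B(kR)` times the sup bound, the latter inherited from the operator norm.
  refine (EllOne.norm_le_card_mul (EllOne.matrix_pow_apply_eq_zero hzR k i j) fun x =>
    (norm_apply_le_norm_ellOneInclusion _ x).trans hk).trans_eq ?_
  ring

theorem isSpectralOver_matrixGroupAlgebra (hΓ : HasSubexponentialGrowth Γ) (n : ℕ) :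
    IsSpectralOver (amplification n (ellOneInclusion Γ)) (matrixGroupAlgebra Γ n) := by
  obtain ⟨ε, hε, hnε⟩ : ∃ ε : ℝ, 0 < ε ∧ n * ε < 1 := by
    -- Taking `n + 1` rather than `n` gives strict inequality and covers `n = 0`.
    refine ⟨1 / (n + 1), by positivity, ?_⟩
    rw [mul_one_div, div_lt_one (by positivity)]
    exact lt_add_one _
  have hU : {w : Matrix (Fin n) (Fin n) (reducedCStarAlgebra Γ) | ∀ i j, ‖w i j‖ ≤ ε} ∈ 𝓝 0 := by
    refine eventually_all.2 fun i => eventually_all.2 fun j => ?_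
    have hc : Continuous fun w : Matrix (Fin n) (Fin n) (reducedCStarAlgebra Γ) => ‖w i j‖ :=
      (continuous_id.matrix_elem i j).norm
    exact (hc.tendsto' 0 0 (by simp)).eventually (ge_mem_nhds hε)
  refine IsSpectralOver.of_isUnit_one_sub (dense_amplification_image n) hU fun z hz hzU => ?_
  have h := summable_matrix_pow hΓ hz hε.le hnε hzU
  exact isUnit_iff_exists.2 ⟨_, h.one_sub_mul_tsum_pow, h.tsum_pow_mul_one_sub⟩

end Reduced

end SpectralMorphism

open SpectralMorphism in
theorem mainTheorem7 (Γ : Type*) [Group Γ] [Group.FG Γ] (hΓ : HasSubexponentialGrowth Γ) :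
    -- the continuous morphism from `ℓ¹Γ` to the reduced C*-algebra is a dense inclusion
    Function.Injective (ellOneInclusion Γ) ∧
    DenseRange (ellOneInclusion Γ) ∧
    -- it is completely relatively spectral
    IsCompletelyRelativelySpectral (ellOneInclusion Γ) ∧
    -- and the dense subalgebras `M_n(ℂΓ)` witness this
    ∀ n : ℕ, Dense (matrixGroupAlgebra Γ n : Set (Matrix (Fin n) (Fin n) (EllOne Γ))) ∧
      IsSpectralOver (amplification n (ellOneInclusion Γ)) (matrixGroupAlgebra Γ n) := by
  exact ⟨injective_ellOneInclusion, denseRange_ellOneInclusion,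
    fun n => ⟨_, dense_matrixGroupAlgebra n, isSpectralOver_matrixGroupAlgebra hΓ n⟩,
    fun n => ⟨dense_matrixGroupAlgebra n, isSpectralOver_matrixGroupAlgebra hΓ n⟩⟩
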